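/- For $0<\rho<1$ let $D_\rho(1-\rho)=\{w\in\mathbb{C}: |w-(1-\rho)|\le\rho\}$, and for an integer $n\ge 1$ let \[ \kappa_{\mathrm{Littlewood}}(\rho,n)=\min_{P}\ \max_{w\in D_\rho(1-\rho)}|P(w)|, \] where the minimum is over all polynomials $P(w)=b_0+b_1w+\cdots+b_{n-1}w^{n-1}$ with coefficients $b_i\in\{-1,0,1\}$, not all $0$. There are universal constants $C\ge 1$ and $c>0$ such that, for every integer $n\ge 2$, \[ \kappa_{\mathrm{Littlewood}}(1-\delta,n)\le \exp\bigl(-c(\delta n)^{1/3}\bigr)\quad\text{whenever } C(\log n)^3/n\le\delta\le 1/2, \] \[ \kappa_{\mathrm{Littlewood}}(\rho,n)\le \exp\bigl(-c(n/\rho)^{1/3}\bigr)\quad\text{whenever } C/n^{1/2}\le\rho\le 1/2. \] -/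

import Mathlib

open Polynomial

/-- The nonzero complex polynomials of degree less than `n` all of whose coefficients lie in
`{-1, 0, 1}`. -/
def littlewoodPolys (n : ℕ) : Set ℂ[X] :=
  {P | P ≠ 0 ∧ P.degree < (n : WithBot ℕ) ∧ ∀ i, P.coeff i ∈ ({-1, 0, 1} : Set ℂ)}

/-- The maximum of `|P(w)|` over the closed disk of radius `ρ` centred at `1 - ρ`. -/
noncomputable def diskMax (ρ : ℝ) (P : ℂ[X]) : ℝ :=
  sSup ((fun w : ℂ => ‖P.eval w‖) '' Metric.closedBall ((1 - ρ : ℝ) : ℂ) ρ)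

/-- The minimum over the polynomials in `littlewoodPolys n` of the maximum modulus on the closed
disk of radius `ρ` centred at `1 - ρ`. -/
noncomputable def kappaLittlewood (ρ : ℝ) (n : ℕ) : ℝ :=
  sInf (diskMax ρ '' littlewoodPolys n)

/-- The supremum defining `diskMax` is an attained maximum. -/
theorem isGreatest_diskMax {ρ : ℝ} (hρ : 0 ≤ ρ) (P : ℂ[X]) :
    IsGreatest ((fun w : ℂ => ‖P.eval w‖) '' Metric.closedBall ((1 - ρ : ℝ) : ℂ) ρ)
      (diskMax ρ P) := by
  have hc : IsCompact ((fun w : ℂ => ‖P.eval w‖) '' Metric.closedBall ((1 - ρ : ℝ) : ℂ) ρ) :=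
    (isCompact_closedBall _ _).image (by fun_prop)
  exact hc.isGreatest_sSup ((Metric.nonempty_closedBall.2 hρ).image _)

theorem littlewoodPolys_finite (n : ℕ) : (littlewoodPolys n).Finite := by
  have hfin : (Set.pi Set.univ (fun _ : Fin n => ({-1, 0, 1} : Set ℂ))).Finite :=
    Set.Finite.pi fun _ => by simp
  refine Set.Finite.of_finite_image (f := fun (P : ℂ[X]) (i : Fin n) => P.coeff i)
    (hfin.subset ?_) ?_
  · rintro _ ⟨P, hP, rfl⟩ i -
    exact hP.2.2 i
  · intro P hP Q hQ h
    ext i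
    by_cases hi : i < n
    · exact congrFun h ⟨i, hi⟩
    · have hle : (n : WithBot ℕ) ≤ (i : WithBot ℕ) := by exact_mod_cast not_lt.1 hi
      rw [coeff_eq_zero_of_degree_lt (hP.2.1.trans_le hle),
        coeff_eq_zero_of_degree_lt (hQ.2.1.trans_le hle)]

theorem littlewoodPolys_nonempty {n : ℕ} (hn : 0 < n) : (littlewoodPolys n).Nonempty := by
  refine ⟨1, one_ne_zero, ?_, fun i => ?_⟩
  · rw [degree_one]
    exact_mod_cast hn
  · rw [coeff_one]
    split_ifs <;> simp

/-- The infimum defining `kappaLittlewood` is an attained minimum. -/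
theorem isLeast_kappaLittlewood (ρ : ℝ) {n : ℕ} (hn : 0 < n) :
    IsLeast (diskMax ρ '' littlewoodPolys n) (kappaLittlewood ρ n) :=
  ⟨((littlewoodPolys_nonempty hn).image _).csInf_mem ((littlewoodPolys_finite n).image _),
    fun _ hx => csInf_le ((littlewoodPolys_finite n).image _).bddBelow hx⟩

/-!
Write `w = 1 + u` and `η = (1 - ρ) / ρ`. The disk of radius `ρ` centred at `1 - ρ` is
`‖u‖ ^ 2 + 2 * ρ * re u ≤ 0`, so on it `‖w‖ ^ 2 ≤ 1 - η * ‖u‖ ^ 2`, and therefore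
`‖w‖ ^ N ≤ exp (-N * η * ‖u‖ ^ 2 / 2)` (`norm_pow_le_exp_of_mem_closedBall`). Multiplying a fixed
polynomial by a high power of `w` thus makes it small on the disk except near `w = 1`.

Near `w = 1` smallness comes from the pigeonhole principle
(`exists_littlewood_eight_mul_sq`). Among the `2 ^ (8 * q ^ 2)` polynomials with coefficients in
`{0, 1}` and degree less than `8 * q ^ 2`, consider the first `2 * q` Taylor coefficients at `1`,
scaled to radius `r = 1 / (32 * q)`. Each is at most `exp (O(q))`, so up to an error `exp (-q)` there
are fewer than `exp (4 * q ^ 2) < 2 ^ (8 * q ^ 2)` possible vectors. Two distinct polynomials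
therefore agree up to that error, and their difference is a Littlewood polynomial whose first
`2 * q` Taylor terms are negligible for `‖u‖ ≤ r`; the remaining terms are `O(q ^ 2 * exp (-q))`
for every such polynomial.

If `16 * q ^ 2 ≤ n` and `q ^ 3 ≤ η * n`, the product of this difference with a power of `w` of
exponent at least `n / 2` is at most `exp (-q / 8192)` on the whole disk, since for `‖u‖ ≥ r` the
exponent `n * η * r ^ 2` is at least of order `q` (`kappaLittlewood_le_exp_nat`). Both ranges of the
theorem follow by taking `q` proportional to `(δ * n) ^ (1 / 3)`, respectively to
`(n / ρ) ^ (1 / 3)`; in the second one the lower bound on `ρ` is what ensures `16 * q ^ 2 ≤ n`.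
-/

/-! ### Taylor coefficients at `1` and the pigeonhole principle -/

open Finset in
theorem one_add_pow_eq_sum_range {R : Type*} [CommSemiring R] (u : R) {j m : ℕ} (hj : j < m) :
    (1 + u) ^ j = ∑ i ∈ range m, u ^ i * (j.choose i : R) := by
  rw [add_comm, add_pow]
  simp only [one_pow, mul_one]
  refine sum_subset (range_subset_range.2 hj) fun i _ hi => ?_
  rw [Nat.choose_eq_zero_of_lt (by simpa using hi)]
  simp

open Finset in
theorem sum_choose_mul_pow_le {x : ℝ} (hx : 0 ≤ x) (m : ℕ) :
    ∑ i ∈ range m, x ^ i * ∑ j ∈ range m, (j.choose i : ℝ) ≤ m * (1 + x) ^ m := by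
  simp only [mul_sum]
  rw [sum_comm]
  calc ∑ j ∈ range m, ∑ i ∈ range m, x ^ i * (j.choose i : ℝ)
      = ∑ j ∈ range m, (1 + x) ^ j :=
        sum_congr rfl fun j hj => (one_add_pow_eq_sum_range x (mem_range.1 hj)).symm
    _ ≤ ∑ _j ∈ range m, (1 + x) ^ m :=
        sum_le_sum fun j hj => pow_le_pow_right₀ (by linarith) (mem_range.1 hj).le
    _ = m * (1 + x) ^ m := by simp

open Finset in
/-- Two distinct polynomials with coefficients in `{0, 1}`, given by their supports `S` and `T`,
have nearly equal Taylor coefficients at `1` up to order `l`, once there are more supports than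
cells of size `τ` for the coefficient vectors scaled to radius `r`. -/
theorem exists_ne_abs_sum_choose_sub_le {m l B : ℕ} {r τ : ℝ} (hr : 0 ≤ r) (hτ : 0 < τ)
    (hB : m * (1 + r) ^ m / τ < B) (hcard : B ^ l < 2 ^ m) :
    ∃ S ⊆ range m, ∃ T ⊆ range m, S ≠ T ∧ ∀ i < l,
      r ^ i * |∑ j ∈ S, (j.choose i : ℝ) - ∑ j ∈ T, (j.choose i : ℝ)| ≤ τ := by
  have hnn (S : Finset ℕ) (i : ℕ) : 0 ≤ (r ^ i * ∑ j ∈ S, (j.choose i : ℝ)) / τ := by positivity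
  obtain ⟨S, hS, T, hT, hne, h⟩ := exists_ne_map_eq_of_card_lt_of_maps_to
    (s := (range m).powerset) (t := Fintype.piFinset fun _ : Fin l => range B)
    (f := fun S (i : Fin l) => ⌊(r ^ (i : ℕ) * ∑ j ∈ S, (j.choose i : ℝ)) / τ⌋₊)
    (by simpa using hcard) (by
      intro S hS
      simp only [coe_powerset, Set.mem_preimage, Set.mem_powerset_iff, coe_subset] at hS
      simp only [Fintype.coe_piFinset, Set.mem_pi, coe_range, Set.mem_Iio]
      intro i _
      rw [Nat.floor_lt (hnn S i)]
      refine lt_of_le_of_lt (div_le_div_of_nonneg_right ?_ hτ.le) hB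
      calc r ^ (i : ℕ) * ∑ j ∈ S, (j.choose i : ℝ)
          ≤ r ^ (i : ℕ) * ∑ j ∈ range m, (j.choose i : ℝ) := by gcongr
        _ = ∑ j ∈ range m, r ^ (i : ℕ) * (j.choose i : ℝ) := mul_sum _ _ _
        _ ≤ ∑ j ∈ range m, (1 + r) ^ j := by
            refine sum_le_sum fun j _ => ?_
            rcases le_or_gt (i : ℕ) j with hij | hij
            · rw [one_add_pow_eq_sum_range r j.lt_succ_self]
              exact single_le_sum (f := fun i => r ^ i * (j.choose i : ℝ))
                (fun _ _ => by positivity) (mem_range.2 (Nat.lt_succ_of_le hij))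
            · rw [Nat.choose_eq_zero_of_lt hij]
              simp only [Nat.cast_zero, mul_zero]
              positivity
        _ ≤ ∑ _j ∈ range m, (1 + r) ^ m :=
            sum_le_sum fun j hj => pow_le_pow_right₀ (by linarith) (mem_range.1 hj).le
        _ = m * (1 + r) ^ m := by simp)
  refine ⟨S, mem_powerset.1 hS, T, mem_powerset.1 hT, hne, fun i hi => ?_⟩
  have hfl := congrFun h ⟨i, hi⟩
  simp only at hfl
  have h1 := Nat.floor_le (hnn S i)
  have h2 := Nat.lt_floor_add_one ((r ^ i * ∑ j ∈ S, (j.choose i : ℝ)) / τ)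
  have h3 := Nat.floor_le (hnn T i)
  have h4 := Nat.lt_floor_add_one ((r ^ i * ∑ j ∈ T, (j.choose i : ℝ)) / τ)
  rw [hfl] at h1 h2
  rw [← abs_of_nonneg (pow_nonneg hr i), ← abs_mul, mul_sub, ← div_le_one hτ,
    ← abs_of_pos hτ, ← abs_div, sub_div, abs_le]
  constructor <;> linarith

open Finset in
/-- Taylor expansion at `1` on the disk of radius `r`: the terms of order below `l` contribute at
most `τ` each, and the others gain a factor `Λ⁻¹ ^ l` by comparison with the radius `Λ * r`. -/
theorem norm_sum_mul_one_add_pow_le {m l : ℕ} {r τ Λ : ℝ} (hτ : 0 ≤ τ) (hΛ : 1 ≤ Λ)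
    {b : ℕ → ℂ} (hb : ∀ j, ‖b j‖ ≤ 1)
    (hsmall : ∀ i < l, r ^ i * ‖∑ j ∈ range m, b j * (j.choose i : ℂ)‖ ≤ τ)
    {u : ℂ} (hu : ‖u‖ ≤ r) :
    ‖∑ j ∈ range m, b j * (1 + u) ^ j‖ ≤ l * τ + m * (1 + Λ * r) ^ m / Λ ^ l := by
  have hr : 0 ≤ r := (norm_nonneg u).trans hu
  have hΛ0 : 0 < Λ := by linarith
  have hexp : ∑ j ∈ range m, b j * (1 + u) ^ j =
      ∑ i ∈ range m, u ^ i * ∑ j ∈ range m, b j * (j.choose i : ℂ) := by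
    simp only [mul_sum]
    rw [sum_comm]
    refine sum_congr rfl fun j hj => ?_
    rw [one_add_pow_eq_sum_range u (mem_range.1 hj), mul_sum]
    exact sum_congr rfl fun i _ => by ring
  have hterm (i : ℕ) : ‖u ^ i * ∑ j ∈ range m, b j * (j.choose i : ℂ)‖ ≤
      (if i < l then τ else 0) +
        ((Λ * r) ^ i * ∑ j ∈ range m, (j.choose i : ℝ)) / Λ ^ l := by
    have h1 : ‖u ^ i * ∑ j ∈ range m, b j * (j.choose i : ℂ)‖ ≤
        r ^ i * ‖∑ j ∈ range m, b j * (j.choose i : ℂ)‖ := by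
      rw [norm_mul, norm_pow]
      gcongr
    split_ifs with hi
    · have : 0 ≤ ((Λ * r) ^ i * ∑ j ∈ range m, (j.choose i : ℝ)) / Λ ^ l := by positivity
      linarith [hsmall i hi]
    · have h2 : ‖∑ j ∈ range m, b j * (j.choose i : ℂ)‖ ≤ ∑ j ∈ range m, (j.choose i : ℝ) := by
        refine (norm_sum_le _ _).trans (sum_le_sum fun j _ => ?_)
        rw [norm_mul, Complex.norm_natCast]
        exact mul_le_of_le_one_left (by positivity) (hb j)
      have h3 : (1 : ℝ) ≤ Λ ^ i / Λ ^ l := by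
        rw [one_le_div (by positivity)]
        exact pow_le_pow_right₀ hΛ (not_lt.1 hi)
      calc _ ≤ r ^ i * ∑ j ∈ range m, (j.choose i : ℝ) := h1.trans (by gcongr)
        _ ≤ (Λ ^ i / Λ ^ l) * (r ^ i * ∑ j ∈ range m, (j.choose i : ℝ)) :=
            le_mul_of_one_le_left (by positivity) h3
        _ = _ := by rw [mul_pow]; ring
  rw [hexp]
  refine (norm_sum_le _ _).trans ((sum_le_sum fun i _ => hterm i).trans ?_)
  rw [sum_add_distrib, ← sum_div]
  refine add_le_add ?_ (by gcongr; exact sum_choose_mul_pow_le (by positivity) m)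
  rw [← sum_filter, sum_const, nsmul_eq_mul]
  gcongr
  calc _ ≤ #(range l) := card_le_card fun i hi => by
        simpa using (mem_filter.1 hi).2
    _ = l := card_range l

/-! ### Littlewood polynomials that are small near `1` -/

theorem eval_eq_sum_of_mem_littlewoodPolys {m : ℕ} {P : ℂ[X]} (hP : P ∈ littlewoodPolys m)
    (w : ℂ) : P.eval w = ∑ j ∈ Finset.range m, P.coeff j * w ^ j := by
  refine Polynomial.eval_eq_sum_range' ?_ w
  exact (natDegree_lt_iff_degree_lt hP.1).2 hP.2.1

theorem norm_coeff_le_one_of_mem_littlewoodPolys {m : ℕ} {P : ℂ[X]}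
    (hP : P ∈ littlewoodPolys m) (j : ℕ) : ‖P.coeff j‖ ≤ 1 := by
  rcases hP.2.2 j with h | h | h <;> rw [h] <;> simp

open Finset in
theorem exists_littlewood_norm_eval_le {m l B : ℕ} {r τ Λ : ℝ} (hr : 0 ≤ r) (hτ : 0 < τ)
    (hΛ : 1 ≤ Λ) (hB : m * (1 + r) ^ m / τ < B) (hcard : B ^ l < 2 ^ m) :
    ∃ P ∈ littlewoodPolys m, ∀ u : ℂ, ‖u‖ ≤ r →
      ‖P.eval (1 + u)‖ ≤ l * τ + m * (1 + Λ * r) ^ m / Λ ^ l := by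
  obtain ⟨S, hS, T, hT, hne, h⟩ := exists_ne_abs_sum_choose_sub_le hr hτ hB hcard
  have hcoeff (U : Finset ℕ) (i : ℕ) :
      (∑ j ∈ U, (X : ℂ[X]) ^ j).coeff i = if i ∈ U then 1 else 0 := by
    simp [coeff_X_pow]
  set P : ℂ[X] := ∑ j ∈ S, X ^ j - ∑ j ∈ T, X ^ j with hPdef
  have hPc (i : ℕ) : P.coeff i = (if i ∈ S then 1 else 0) - (if i ∈ T then 1 else 0) := by
    rw [hPdef, coeff_sub, hcoeff, hcoeff]
  have hP : P ∈ littlewoodPolys m := by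
    refine ⟨fun h0 => hne ?_, ?_, fun i => ?_⟩
    · ext i
      have := hPc i
      rw [h0, coeff_zero] at this
      by_cases h1 : i ∈ S <;> by_cases h2 : i ∈ T <;> simp [h1, h2] at this ⊢
    · rw [degree_lt_iff_coeff_zero]
      intro i hi
      have h1 : i ∉ S := fun h => by have := mem_range.1 (hS h); omega
      have h2 : i ∉ T := fun h => by have := mem_range.1 (hT h); omega
      simp [hPc, h1, h2]
    · rw [hPc]
      split_ifs <;> simp
  refine ⟨P, hP, fun u hu => ?_⟩
  rw [eval_eq_sum_of_mem_littlewoodPolys hP]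
  refine norm_sum_mul_one_add_pow_le hτ.le hΛ (norm_coeff_le_one_of_mem_littlewoodPolys hP)
    (fun i hi => ?_) hu
  have hsum : ∑ j ∈ range m, P.coeff j * (j.choose i : ℂ) =
      ((∑ j ∈ S, (j.choose i : ℝ) - ∑ j ∈ T, (j.choose i : ℝ) : ℝ) : ℂ) := by
    simp only [hPc, sub_mul, sum_sub_distrib, ite_mul, one_mul, zero_mul, ← sum_filter]
    rw [filter_mem_eq_inter, filter_mem_eq_inter, inter_eq_right.2 hS, inter_eq_right.2 hT]
    push_cast
    rfl
  rw [hsum, Complex.norm_real, Real.norm_eq_abs]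
  exact h i hi

theorem norm_one_add_pow_le_exp {x : ℝ} (hx : 0 ≤ x) (m : ℕ) : (1 + x) ^ m ≤ Real.exp (m * x) := by
  rw [Real.exp_nat_mul]
  gcongr
  linarith [Real.add_one_le_exp x]

/-- The parameters are balanced at length `8 * q ^ 2`, Taylor order `2 * q` and radius
`1 / (32 * q)`; `hq'` holds for all large `q`. -/
theorem exists_littlewood_eight_mul_sq {q : ℕ} (hq : 0 < q)
    (hq' : 8 * (q : ℝ) ^ 2 * Real.exp (5 / 4 * q) + 1 < Real.exp (2 * q)) :
    ∃ P ∈ littlewoodPolys (8 * q ^ 2), ∀ u : ℂ, ‖u‖ ≤ 1 / (32 * q) →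
      ‖P.eval (1 + u)‖ ≤ (2 * q + 8 * q ^ 2) * Real.exp (-q) := by
  have hq0 : (0 : ℝ) < q := by exact_mod_cast hq
  set B := ⌊8 * (q : ℝ) ^ 2 * Real.exp (5 / 4 * q)⌋₊ + 1 with hBdef
  have hr : (0 : ℝ) ≤ 1 / (32 * q) := by positivity
  have hB : ((8 * q ^ 2 : ℕ) : ℝ) * (1 + 1 / (32 * q)) ^ (8 * q ^ 2) / Real.exp (-q) < B := by
    have h1 := norm_one_add_pow_le_exp hr (8 * q ^ 2)
    have h2 : (((8 * q ^ 2 : ℕ) : ℝ)) * (1 / (32 * q)) = q / 4 := by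
      push_cast
      field_simp
      norm_num
    rw [h2] at h1
    rw [Real.exp_neg, div_inv_eq_mul, hBdef]
    push_cast
    refine lt_of_le_of_lt ?_ (Nat.lt_floor_add_one _)
    rw [show (5 / 4 * q : ℝ) = q / 4 + q by ring, Real.exp_add, ← mul_assoc]
    gcongr
  have hB2 : (B : ℝ) ≤ Real.exp (2 * q) := by
    rw [hBdef]
    push_cast
    linarith [Nat.floor_le (show 0 ≤ 8 * (q : ℝ) ^ 2 * Real.exp (5 / 4 * q) by positivity)]
  have hcard : B ^ (2 * q) < 2 ^ (8 * q ^ 2) := by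
    have h : (B : ℝ) ^ (2 * q) < 2 ^ (8 * q ^ 2) := by
      calc (B : ℝ) ^ (2 * q) ≤ Real.exp (2 * q) ^ (2 * q) := by gcongr
        _ = Real.exp 1 ^ (4 * q ^ 2) := by
            rw [← Real.exp_nat_mul, ← Real.exp_nat_mul]
            push_cast
            ring_nf
        -- The count succeeds because `exp 1 < 2 ^ 2`.
        _ < (2 ^ 2) ^ (4 * q ^ 2) := by
            refine pow_lt_pow_left₀ ?_ (by positivity) (by positivity)
            linarith [Real.exp_one_lt_d9]
        _ = 2 ^ (8 * q ^ 2) := by rw [← pow_mul]; ring_nf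
    exact_mod_cast h
  obtain ⟨P, hP, h⟩ := exists_littlewood_norm_eval_le (Λ := 4) hr (Real.exp_pos _) (by norm_num)
    hB hcard
  refine ⟨P, hP, fun u hu => (h u hu).trans ?_⟩
  have h1 := norm_one_add_pow_le_exp (show (0 : ℝ) ≤ 4 * (1 / (32 * q)) by positivity) (8 * q ^ 2)
  have h2 : (((8 * q ^ 2 : ℕ) : ℝ)) * (4 * (1 / (32 * q))) = q := by
    push_cast
    field_simp
    norm_num
  rw [h2] at h1
  -- With `Λ = 4` the tail is at most `8 * q ^ 2 * exp q / 4 ^ (2 * q)`, and `exp 1 ≤ 4`.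
  have h3 : Real.exp q * Real.exp q ≤ 4 ^ (2 * q) := by
    rw [← Real.exp_add, show (q + q : ℝ) = ((2 * q : ℕ) : ℝ) * 1 by push_cast; ring,
      Real.exp_nat_mul]
    gcongr
    linarith [Real.exp_one_lt_d9]
  rw [add_mul]
  push_cast
  refine add_le_add le_rfl ?_
  rw [mul_div_assoc]
  refine mul_le_mul_of_nonneg_left ?_ (by positivity)
  rw [div_le_iff₀ (by positivity)]
  calc _ ≤ Real.exp q := h1
    _ = Real.exp (-q) * (Real.exp q * Real.exp q) := by
      rw [← mul_assoc, ← Real.exp_add]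
      simp
    _ ≤ _ := by gcongr

/-! ### Decay of powers on the disk -/

theorem norm_sq_le_of_mem_closedBall {ρ : ℝ} (hρ : 0 < ρ) {w : ℂ}
    (hw : w ∈ Metric.closedBall ((1 - ρ : ℝ) : ℂ) ρ) :
    ‖w‖ ^ 2 ≤ 1 - (1 - ρ) / ρ * ‖w - 1‖ ^ 2 := by
  rw [Metric.mem_closedBall, dist_eq_norm] at hw
  have h := pow_le_pow_left₀ (norm_nonneg _) hw 2
  rw [Complex.sq_norm, Complex.normSq_apply] at h ⊢
  rw [Complex.sq_norm, Complex.normSq_apply]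
  simp only [Complex.sub_re, Complex.sub_im, Complex.ofReal_re, Complex.ofReal_im,
    Complex.one_re, Complex.one_im] at h ⊢
  rw [div_mul_eq_mul_div, le_sub_iff_add_le, ← le_sub_iff_add_le', div_le_iff₀ hρ]
  nlinarith

theorem norm_pow_le_exp_of_mem_closedBall {ρ : ℝ} (hρ : 0 < ρ) {w : ℂ}
    (hw : w ∈ Metric.closedBall ((1 - ρ : ℝ) : ℂ) ρ) (N : ℕ) :
    ‖w‖ ^ N ≤ Real.exp (-(N * ((1 - ρ) / ρ) * ‖w - 1‖ ^ 2 / 2)) := by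
  have h1 : ‖w‖ ^ 2 ≤ Real.exp (-((1 - ρ) / ρ * ‖w - 1‖ ^ 2 / 2)) ^ 2 := by
    rw [← Real.exp_nat_mul]
    refine (norm_sq_le_of_mem_closedBall hρ hw).trans ?_
    refine le_trans (le_of_eq (by push_cast; ring)) (Real.add_one_le_exp _)
  have h2 := pow_le_pow_left₀ (norm_nonneg w) (le_of_sq_le_sq h1 (Real.exp_pos _).le) N
  refine h2.trans (le_of_eq ?_)
  rw [← Real.exp_nat_mul]
  ring_nf

/-! ### Bounds for the minimum -/

theorem mul_X_pow_mem_littlewoodPolys {m n : ℕ} (hmn : m ≤ n) {P : ℂ[X]}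
    (hP : P ∈ littlewoodPolys m) : P * X ^ (n - m) ∈ littlewoodPolys n := by
  refine ⟨mul_ne_zero hP.1 (pow_ne_zero _ X_ne_zero), ?_, fun i => ?_⟩
  · rw [degree_lt_iff_coeff_zero]
    intro i hi
    rw [coeff_mul_X_pow', if_pos (by omega)]
    exact (degree_lt_iff_coeff_zero _ _).1 hP.2.1 _ (by omega)
  · rw [coeff_mul_X_pow']
    split_ifs
    · exact hP.2.2 _
    · simp

theorem kappaLittlewood_le_of_forall {ρ b : ℝ} (hρ : 0 ≤ ρ) {n : ℕ} {P : ℂ[X]}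
    (hP : P ∈ littlewoodPolys n)
    (h : ∀ w ∈ Metric.closedBall ((1 - ρ : ℝ) : ℂ) ρ, ‖P.eval w‖ ≤ b) :
    kappaLittlewood ρ n ≤ b := by
  refine (csInf_le ((littlewoodPolys_finite n).image _).bddBelow ⟨P, hP, rfl⟩).trans ?_
  obtain ⟨w, hw, hwe⟩ := (isGreatest_diskMax hρ P).1
  rw [← hwe]
  exact h w hw

/-- The bound in terms of an integer parameter `q`. The hypotheses `h1`, `h2`, `h3` hold for all
large `q`. -/
theorem kappaLittlewood_le_exp_nat {ρ : ℝ} (hρ : 0 < ρ) (hρ1 : ρ ≤ 1) {n q : ℕ} (hq : 0 < q)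
    (hqn : 16 * q ^ 2 ≤ n) (hqρ : (q : ℝ) ^ 3 ≤ (1 - ρ) / ρ * n)
    (h1 : 8 * (q : ℝ) ^ 2 * Real.exp (5 / 4 * q) + 1 < Real.exp (2 * q))
    (h2 : (2 * q + 8 * q ^ 2) * Real.exp (-q) ≤ Real.exp (-(q / 8192)))
    (h3 : 8 * (q : ℝ) ^ 2 * Real.exp (-(q / 4096)) ≤ Real.exp (-(q / 8192))) :
    kappaLittlewood ρ n ≤ Real.exp (-(q / 8192)) := by
  have hq0 : (0 : ℝ) < q := by exact_mod_cast hq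
  have hη : 0 ≤ (1 - ρ) / ρ := div_nonneg (by linarith) hρ.le
  obtain ⟨P, hP, hPs⟩ := exists_littlewood_eight_mul_sq hq h1
  refine kappaLittlewood_le_of_forall hρ.le
    (mul_X_pow_mem_littlewoodPolys (show 8 * q ^ 2 ≤ n by omega) hP) fun w hw => ?_
  rw [eval_mul, eval_pow, eval_X, norm_mul, norm_pow]
  have hw1 : ‖w‖ ≤ 1 := by
    have := norm_sq_le_of_mem_closedBall hρ hw
    have h4 : 0 ≤ (1 - ρ) / ρ * ‖w - 1‖ ^ 2 := by positivity
    nlinarith [norm_nonneg w]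
  -- Near `1` the polynomial `P` is small; elsewhere the power of `w` is.
  rcases le_total ‖w - 1‖ (1 / (32 * q)) with hnear | hfar
  · have h4 := hPs (w - 1) hnear
    rw [add_sub_cancel] at h4
    calc ‖P.eval w‖ * ‖w‖ ^ (n - 8 * q ^ 2) ≤ ‖P.eval w‖ * 1 := by
          gcongr
          exact pow_le_one₀ (norm_nonneg _) hw1
      _ ≤ _ := by linarith
  · have h4 : ‖P.eval w‖ ≤ 8 * q ^ 2 := by
      rw [eval_eq_sum_of_mem_littlewoodPolys hP]
      calc _ ≤ ∑ j ∈ Finset.range (8 * q ^ 2), ‖P.coeff j * w ^ j‖ := norm_sum_le _ _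
        _ ≤ ∑ _j ∈ Finset.range (8 * q ^ 2), (1 : ℝ) := by
            refine Finset.sum_le_sum fun j _ => ?_
            rw [norm_mul, norm_pow]
            exact mul_le_one₀ (norm_coeff_le_one_of_mem_littlewoodPolys hP j) (by positivity)
              (pow_le_one₀ (norm_nonneg _) hw1)
        _ = _ := by simp
    have hN : (n : ℝ) / 2 ≤ ((n - 8 * q ^ 2 : ℕ) : ℝ) := by
      rw [Nat.cast_sub (by omega)]
      have : ((16 * q ^ 2 : ℕ) : ℝ) ≤ n := by exact_mod_cast hqn
      push_cast at this ⊢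
      linarith
    have h5 : (q : ℝ) / 4096 ≤
        ((n - 8 * q ^ 2 : ℕ) : ℝ) * ((1 - ρ) / ρ) * ‖w - 1‖ ^ 2 / 2 := by
      calc (q : ℝ) / 4096 = (q : ℝ) ^ 3 / 2 * (1 / (32 * q)) ^ 2 / 2 := by
            field_simp
            norm_num
        _ ≤ ((1 - ρ) / ρ * n) / 2 * ‖w - 1‖ ^ 2 / 2 := by gcongr
        _ = (n : ℝ) / 2 * ((1 - ρ) / ρ) * ‖w - 1‖ ^ 2 / 2 := by ring
        _ ≤ _ := by gcongr
    refine le_trans ?_ h3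
    refine mul_le_mul h4 ((norm_pow_le_exp_of_mem_closedBall hρ hw _).trans ?_) (by positivity)
      (by positivity)
    exact Real.exp_le_exp.2 (neg_le_neg h5)

open Filter Topology in
theorem eventually_kappaLittlewood_numerics : ∀ᶠ x : ℝ in atTop,
    8 * x ^ 2 * Real.exp (5 / 4 * x) + 1 < Real.exp (2 * x) ∧
    (2 * x + 8 * x ^ 2) * Real.exp (-x) ≤ Real.exp (-(x / 8192)) ∧
    8 * x ^ 2 * Real.exp (-(x / 4096)) ≤ Real.exp (-(x / 8192)) := by
  have h : ∀ᶠ x : ℝ in atTop, x ^ 2 ≤ 1 / 16 * Real.exp (1 / 8192 * x) :=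
    ((isLittleO_pow_exp_pos_mul_atTop 2 (b := 1 / 8192) (by norm_num)).bound
      (show (0 : ℝ) < 1 / 16 by norm_num)).mono fun x hx => by
        simpa [abs_of_nonneg (sq_nonneg x)] using hx
  filter_upwards [h, eventually_ge_atTop 1] with x hx hx1
  have hmul (a b : ℝ) (hab : 1 / 8192 * x + a ≤ b) :
      16 * x ^ 2 * Real.exp a ≤ Real.exp b := by
    calc 16 * x ^ 2 * Real.exp a ≤ Real.exp (1 / 8192 * x) * Real.exp a := by
          gcongr
          linarith
      _ = Real.exp (1 / 8192 * x + a) := (Real.exp_add _ _).symm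
      _ ≤ _ := Real.exp_le_exp.2 hab
  refine ⟨?_, ?_, ?_⟩
  · have h1 := hmul (5 / 4 * x) (2 * x) (by linarith)
    have h2 : 1 < Real.exp (5 / 4 * x) := Real.one_lt_exp_iff.2 (by linarith)
    nlinarith [Real.exp_pos (5 / 4 * x)]
  · refine le_trans ?_ (hmul (-x) (-(x / 8192)) (by linarith))
    gcongr
    nlinarith
  · refine le_trans ?_ (hmul (-(x / 4096)) (-(x / 8192)) (by linarith))
    gcongr
    norm_num

/-- The common form of the two ranges of the radius, with a real parameter `x` from which the
integer `q = ⌊x / 4⌋₊` is obtained. -/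
theorem exists_kappaLittlewood_le_exp : ∃ K : ℝ, 8 ≤ K ∧ ∀ (n : ℕ) (ρ x : ℝ), 0 < ρ → ρ ≤ 1 →
    K ≤ x → x ^ 2 ≤ n → x ^ 3 ≤ 64 * ((1 - ρ) / ρ * n) →
    kappaLittlewood ρ n ≤ Real.exp (-(1 / 65536 * x)) := by
  obtain ⟨Q, hQ⟩ := Filter.eventually_atTop.1 eventually_kappaLittlewood_numerics
  refine ⟨max 8 (8 * Q), le_max_left _ _, fun n ρ x hρ hρ1 hx hxn hxρ => ?_⟩
  have hx8 : 8 ≤ x := (le_max_left _ _).trans hx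
  have hxQ : 8 * Q ≤ x := (le_max_right _ _).trans hx
  set q := ⌊x / 4⌋₊
  have hqle : (q : ℝ) ≤ x / 4 := Nat.floor_le (by linarith)
  have hqge : x / 8 ≤ q := by linarith [Nat.lt_floor_add_one (x / 4)]
  have hq0 : (0 : ℝ) < q := by linarith
  obtain ⟨h1, h2, h3⟩ := hQ q (by linarith)
  have hsq := pow_le_pow_left₀ hq0.le hqle 2
  have hcb := pow_le_pow_left₀ hq0.le hqle 3
  refine (kappaLittlewood_le_exp_nat hρ hρ1 (by exact_mod_cast hq0) ?_ ?_ h1 h2 h3).trans ?_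
  · have : 16 * (q : ℝ) ^ 2 ≤ n := by
      rw [div_pow] at hsq
      linarith
    exact_mod_cast this
  · rw [div_pow] at hcb
    linarith
  · exact Real.exp_le_exp.2 (by linarith)

theorem theorem6 :
    ∃ C : ℝ, 1 ≤ C ∧ ∃ c : ℝ, 0 < c ∧ ∀ n : ℕ, 2 ≤ n →
      (∀ δ : ℝ, C * Real.log (n : ℝ) ^ 3 / (n : ℝ) ≤ δ → δ ≤ 1 / 2 →
        kappaLittlewood (1 - δ) n ≤ Real.exp (-(c * (δ * (n : ℝ)) ^ (1 / 3 : ℝ)))) ∧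
      (∀ ρ : ℝ, C / Real.sqrt (n : ℝ) ≤ ρ → ρ ≤ 1 / 2 →
        kappaLittlewood ρ n ≤ Real.exp (-(c * ((n : ℝ) / ρ) ^ (1 / 3 : ℝ)))) := by
  obtain ⟨K, hK8, hK⟩ := exists_kappaLittlewood_le_exp
  have hC1 : 1 ≤ 8 * K ^ 3 := by
    have := one_le_pow₀ (show (1 : ℝ) ≤ K by linarith) (n := 3)
    linarith
  have hcube {y : ℝ} (hy : 0 ≤ y) : (y ^ (1 / 3 : ℝ)) ^ 3 = y := by
    rw [← Real.rpow_natCast, ← Real.rpow_mul hy]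
    norm_num
  refine ⟨8 * K ^ 3, hC1, 1 / 65536, by norm_num, fun n hn => ?_⟩
  have hn2 : (2 : ℝ) ≤ n := by exact_mod_cast hn
  have hn0 : (0 : ℝ) < n := by linarith
  constructor
  · intro δ hδ hδ2
    have hlog : (1 / 2 : ℝ) ≤ Real.log n :=
      le_trans (by linarith [Real.log_two_gt_d9]) (Real.log_le_log (by norm_num) hn2)
    have hKδ : K ^ 3 ≤ δ * n := by
      rw [div_le_iff₀ hn0] at hδ
      have := pow_le_pow_left₀ (by norm_num) hlog 3
      nlinarith [pow_pos (show 0 < K by linarith) 3]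
    have hδn : 0 < δ * n := lt_of_lt_of_le (by positivity) hKδ
    have hδ0 : 0 < δ := pos_of_mul_pos_left hδn hn0.le
    set x := (δ * n) ^ (1 / 3 : ℝ)
    have hx3 : x ^ 3 = δ * n := hcube hδn.le
    have hx0 : 0 ≤ x := by positivity
    have hKx : K ≤ x := le_of_pow_le_pow_left₀ (n := 3) (by norm_num) hx0 (by linarith)
    refine hK n (1 - δ) x (by linarith) (by linarith) hKx ?_ ?_
    · have : x ^ 2 ≤ x ^ 3 := pow_le_pow_right₀ (by linarith) (by norm_num)
      nlinarith
    · have h1 : δ ≤ (1 - (1 - δ)) / (1 - δ) := by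
        rw [le_div_iff₀ (by linarith)]
        nlinarith
      have := mul_le_mul_of_nonneg_right h1 hn0.le
      linarith
  · intro ρ hρ hρ2
    set s := Real.sqrt n
    have hs : s ^ 2 = n := Real.sq_sqrt hn0.le
    have hs0 : 0 < s := Real.sqrt_pos.2 hn0
    have hρ0 : 0 < ρ := lt_of_lt_of_le (by positivity) hρ
    have hρs : 8 * K ^ 3 ≤ ρ * s := by rwa [div_le_iff₀ hs0] at hρ
    have hs1 : 8 * K ^ 3 ≤ s := by nlinarith
    have hnρ : 0 < n / ρ := by positivity
    set x := ((n : ℝ) / ρ) ^ (1 / 3 : ℝ)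
    have hx3 : x ^ 3 = n / ρ := hcube hnρ.le
    have hx0 : 0 ≤ x := by positivity
    have hKx : K ≤ x := by
      refine le_of_pow_le_pow_left₀ (n := 3) (by norm_num) hx0 ?_
      rw [hx3, le_div_iff₀ hρ0]
      nlinarith [pow_pos (show 0 < K by linarith) 3]
    -- `x ^ 3 = s ^ 2 / ρ ≤ s ^ 3`, which is where `1 / √n ≤ ρ` is needed.
    have hxs : x ≤ s := by
      refine le_of_pow_le_pow_left₀ (n := 3) (by norm_num) hs0.le ?_
      rw [hx3, div_le_iff₀ hρ0, ← hs]
      nlinarith [pow_pos hs0 2]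
    refine hK n ρ x hρ0 (by linarith) hKx (by rw [← hs]; gcongr) ?_
    rw [hx3]
    have h1 : 1 / 2 * (n / ρ) ≤ (1 - ρ) / ρ * n := by
      rw [div_mul_eq_mul_div (1 - ρ), mul_div_assoc (1 - ρ)]
      exact mul_le_mul_of_nonneg_right (by linarith) hnρ.le
    linarith
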